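/- For $n\ge 1$ and a finite multiset $S$ of elements of $\mathbb Z_n=\mathbb Z/n\mathbb Z$, let $\mathrm{Cay}(\mathbb Z_n,S)$ be the directed multigraph with vertex set $\mathbb Z_n$ in which the number of arcs from $u$ to $v$ is the multiplicity of $v-u$ in $S$. It is called a circulant multigraph of order $n$ with connection multiset $S$ (loops are allowed); if $S\subseteq\mathbb Z_n\setminus\{0\}$ is a set, it is a circulant graph with connection set $S$. The spectrum of a directed multigraph is the list (multiset, with algebraic multiplicities) of the complex eigenvalues of its adjacency matrix. Two directed multigraphs are isospectral if their spectra are equal, and isomorphic if there is a bijection between their vertex sets that preserves the number of arcs from each vertex to each vertex. Theorem. Let $n=p_1^{r_1}p_2^{r_2}\cdots p_s^{r_s}$, where $s\ge 1$, $p_1<p_2<\cdots<p_s$ are primes and all $r_i\ge 1$. Let $X$ be a circulant graph or multigraph of order $n$ whose connection set or multiset has size $m$ (counted with multiplicity). If $p_1\ge m$, and either $s=1$ or $p_2>p_1(m-1)$, then every circulant graph or multigraph (of any order) that is isospectral to $X$ is isomorphic to $X$. -/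

import Mathlib

/-- A finite directed multigraph on the vertex set `V`, with loops allowed:
`arcs u v` is the number of arcs from `u` to `v`. -/
structure MultiDigraph (V : Type*) where
  /-- The number of arcs from one vertex to another. -/
  arcs : V → V → ℕ

namespace MultiDigraph

/-- The adjacency matrix, over `ℂ`. -/
def adjMatrix {V : Type*} (X : MultiDigraph V) : Matrix V V ℂ :=
  Matrix.of fun u v => (X.arcs u v : ℂ)

/-- The spectrum: the multiset of the complex eigenvalues of the adjacency matrix,
each repeated according to its algebraic multiplicity. -/
noncomputable def spectrum {V : Type*} [Fintype V] [DecidableEq V] (X : MultiDigraph V) :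
    Multiset ℂ :=
  X.adjMatrix.charpoly.roots

/-- Two multidigraphs are isospectral if their spectra agree, with multiplicities. -/
def Isospectral {V W : Type*} [Fintype V] [DecidableEq V] [Fintype W] [DecidableEq W]
    (X : MultiDigraph V) (Y : MultiDigraph W) : Prop :=
  X.spectrum = Y.spectrum

/-- Two multidigraphs are isomorphic if a bijection of the vertices preserves the number of
arcs between any two vertices. -/
def Isomorphic {V W : Type*} (X : MultiDigraph V) (Y : MultiDigraph W) : Prop :=
  ∃ e : V ≃ W, ∀ u v : V, Y.arcs (e u) (e v) = X.arcs u v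

/-- The Cayley multidigraph `Cay(ℤ/n, S)` with connection multiset `S`: for each element `a` of
`S`, counted with multiplicity, and each vertex `u`, one arc from `u` to `u + a`. If `S` has no
repeated elements and does not contain `0`, it is the circulant (di)graph of the set `S`. -/
def circulant {n : ℕ} (S : Multiset (ZMod n)) : MultiDigraph (ZMod n) where
  arcs u v := S.count (v - u)

end MultiDigraph

/-! The eigenvalues of a circulant are the values λ_j(A) = ∑ ζ^(ja) of a Fourier transform, so
isospectrality gives λ_1(A) = λ_i(B) = λ_1(iB) for some i. Let p = p_1. This one equality propagates
to all j prime to p: the difference F of the generating polynomials vanishes at ζ, and |F| ≤ 2m < q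
on the unit circle for every other prime q ∣ n. Since F(X^q) ≡ F(X)^q mod q, F(ζ^q)/q is an
algebraic integer with all conjugates of modulus below 1, hence 0 (`aeval_pow_eq_zero_of_norm_lt`).

The multiplicity function of A minus that of iB then has its transform supported on multiples of p,
so it is periodic under the subgroup of order p. As m ≤ p, either A = iB or both are cosets of that
subgroup (`eq_or_exists_eq_torsionCoset`). By symmetry, either A and B are multiples of each other,
hence differ by a unit (`exists_unit_map_mul_eq`), or both are cosets, which their spectra determine
up to a unit. -/

/-! ### Vanishing of integer polynomials at powers of roots of unity -/

open Polynomial in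
theorem exists_expand_sub_pow_eq (q : ℕ) [Fact q.Prime] (F : ℤ[X]) :
    ∃ H : ℤ[X], expand ℤ q F - F ^ q = C (q : ℤ) * H := by
  have h : C (q : ℤ) ∣ expand ℤ q F - F ^ q := by
    rw [C_dvd_iff_dvd_coeff]
    intro i
    rw [← ZMod.intCast_zmod_eq_zero_iff_dvd, ← eq_intCast (Int.castRingHom (ZMod q)),
      ← coeff_map, Polynomial.map_sub, Polynomial.map_pow, map_expand, ZMod.expand_card, sub_self,
      coeff_zero]
  exact h

open Polynomial NumberField in
/-- If an integer polynomial is smaller than a prime `q` on the unit circle, then its vanishing at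
a root of unity is inherited by the `q`-th power of that root. -/
theorem aeval_pow_eq_zero_of_norm_lt {ξ : ℂ} {N : ℕ} (hN : N ≠ 0) (hξ : ξ ^ N = 1) {q : ℕ}
    [Fact q.Prime] {F : ℤ[X]} (hF : ∀ z : ℂ, ‖z‖ = 1 → ‖aeval z F‖ < q)
    (h0 : aeval ξ F = 0) : aeval (ξ ^ q) F = 0 := by
  have hq : (0 : ℝ) < q := by exact_mod_cast (Fact.out : q.Prime).pos
  obtain ⟨H, hH⟩ := exists_expand_sub_pow_eq q F
  have hint : IsIntegral ℤ ξ := IsIntegral.of_pow (Nat.pos_of_ne_zero hN) (hξ ▸ isIntegral_one)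
  let K := IntermediateField.adjoin ℚ {ξ}
  have : FiniteDimensional ℚ K := IntermediateField.adjoin.finiteDimensional
    (hint.tower_top (A := ℚ))
  have : NumberField K := { }
  let ζ : K := IntermediateField.AdjoinSimple.gen ℚ ξ
  have hζ : algebraMap K ℂ ζ = ξ := IntermediateField.AdjoinSimple.algebraMap_gen ℚ ξ
  have hζN : ζ ^ N = 1 := by
    apply (algebraMap K ℂ).injective
    rw [map_pow, hζ, hξ, map_one]
  have hζint : IsIntegral ℤ ζ := IsIntegral.of_pow (Nat.pos_of_ne_zero hN) (hζN ▸ isIntegral_one)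
  let x : 𝓞 K := ⟨ζ, hζint⟩
  let β : 𝓞 K := aeval x H
  have key : ∀ φ : K →+* ℂ, aeval (φ ζ) F = 0 →
      aeval (φ ζ ^ q) F = q * φ (algebraMap (𝓞 K) K β) := by
    intro φ h
    have h1 := congrArg (aeval (φ ζ)) hH
    have h2 : φ (algebraMap (𝓞 K) K β) = aeval (φ ζ) H := by
      have := hom_eval₂ H (Int.castRingHom (𝓞 K)) (φ.comp (algebraMap (𝓞 K) K)) x
      simp only [β, aeval_def, algebraMap_int_eq]
      rw [RingHom.comp_apply] at this
      rw [this]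
      congr 1
      exact RingHom.ext_int _ _
    rw [h2]
    simpa [h, (Fact.out : q.Prime).ne_zero, expand_aeval] using h1
  have hFζ : aeval ζ F = 0 := by
    apply (algebraMap K ℂ).injective
    rw [← aeval_algebraMap_apply, hζ, h0, map_zero]
  have hconj : ∀ φ : K →+* ℂ, aeval (φ ζ) F = 0 := by
    intro φ
    have := aeval_algHom_apply φ.toIntAlgHom ζ F
    rw [hFζ, map_zero] at this
    exact this
  have hnorm : ∀ φ : K →+* ℂ, ‖φ (algebraMap (𝓞 K) K β)‖ < 1 := by
    intro φ
    have h1 := hF (φ ζ ^ q) (by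
      rw [norm_pow, Complex.norm_eq_one_of_pow_eq_one (n := N) (by rw [← map_pow, hζN, map_one]) hN,
        one_pow])
    rw [key φ (hconj φ), norm_mul, Complex.norm_natCast] at h1
    nlinarith
  -- A nonzero algebraic integer has norm at least 1, so some conjugate has modulus at least 1.
  have hβ : β = 0 := by
    by_contra hne
    have w : InfinitePlace K := Classical.arbitrary _
    have hlt : ∀ z : InfinitePlace K, z β < 1 := fun z => by
      rw [← InfinitePlace.norm_embedding_eq]
      exact hnorm _
    exact absurd (InfinitePlace.one_le_of_lt_one (w := w) hne fun z _ => hlt z) (not_le.2 (hlt w))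
  have := key (algebraMap K ℂ) (hconj _)
  rwa [hζ, hβ, map_zero, map_zero, mul_zero] at this

-- Here ξ and ξ^q are conjugate: they share a minimal polynomial.
open Polynomial in
theorem aeval_pow_eq_zero_of_coprime {ξ : ℂ} {N : ℕ} (hN : N ≠ 0) (hξ : ξ ^ N = 1) {q : ℕ}
    (hq : q.Coprime N) {F : ℤ[X]} (h0 : aeval ξ F = 0) : aeval (ξ ^ q) F = 0 := by
  have hp : IsPrimitiveRoot ξ (orderOf ξ) := IsPrimitiveRoot.orderOf ξ
  have hint : IsIntegral ℤ ξ := IsIntegral.of_pow (Nat.pos_of_ne_zero hN) (hξ ▸ isIntegral_one)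
  have hd : minpoly ℤ ξ ∣ F := minpoly.isIntegrallyClosed_dvd hint h0
  have hm : minpoly ℤ ξ = minpoly ℤ (ξ ^ q) :=
    hp.minpoly_eq_pow_coprime (hq.coprime_dvd_right (orderOf_dvd_of_pow_eq_one hξ))
  obtain ⟨G, rfl⟩ := hd
  rw [map_mul, hm, minpoly.aeval, zero_mul]

open Polynomial in
/-- Vanishing at a root of unity `ξ` is inherited by `ξ ^ j` if the prime factors of `j` either are
prime to the order of `ξ` or exceed the polynomial on the unit circle. -/
theorem aeval_pow_eq_zero {N : ℕ} (hN : N ≠ 0) {F : ℤ[X]} {j : ℕ} (hj : j ≠ 0)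
    (hF : ∀ q : ℕ, q.Prime → q ∣ j → q ∣ N → ∀ z : ℂ, ‖z‖ = 1 → ‖aeval z F‖ < q)
    {ξ : ℂ} (hξ : ξ ^ N = 1) (h0 : aeval ξ F = 0) : aeval (ξ ^ j) F = 0 := by
  induction j using induction_on_primes generalizing ξ with
  | zero => exact absurd rfl hj
  | one => simpa using h0
  | prime_mul p k hp ih =>
    have : Fact p.Prime := ⟨hp⟩
    have h2 : (ξ ^ p) ^ N = 1 := by rw [← pow_mul, mul_comm, pow_mul, hξ, one_pow]
    rw [pow_mul]
    refine ih (right_ne_zero_of_mul hj) (fun q hq hqk => hF q hq (hqk.mul_left p)) h2 ?_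
    by_cases hpN : p ∣ N
    · exact aeval_pow_eq_zero_of_norm_lt hN hξ (hF p hp (dvd_mul_right p k) hpN) h0
    · exact aeval_pow_eq_zero_of_coprime hN hξ ((Nat.Prime.coprime_iff_not_dvd hp).2 hpN) h0

/-! ### Eigenvalues and spectra of circulants -/

namespace MultiDigraph

theorem circulant_isomorphic_map_mul_unit {n : ℕ} (A : Multiset (ZMod n)) (u : (ZMod n)ˣ) :
    (circulant A).Isomorphic (circulant (A.map ((u : ZMod n) * ·))) := by
  refine ⟨Units.mulLeft u, fun v w => ?_⟩
  have := Multiset.count_map_eq_count' (fun x : ZMod n => u * x) A u.mulLeft_bijective.injective (w - v)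
  simpa [circulant, mul_sub] using this

variable {n : ℕ} [NeZero n]

/-- The value at `j` of the Fourier transform of the multiset `A`, which is an eigenvalue of
`circulant A`. -/
noncomputable def circulantEigenvalue (A : Multiset (ZMod n)) (j : ZMod n) : ℂ :=
  (A.map fun a => ZMod.stdAddChar (j * a)).sum

theorem circulantEigenvalue_eq_sum (A : Multiset (ZMod n)) (j : ZMod n) :
    circulantEigenvalue A j = ∑ a, (A.count a : ℂ) * ZMod.stdAddChar (j * a) := by
  rw [circulantEigenvalue, Finset.sum_multiset_map_count]
  simp only [nsmul_eq_mul]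
  refine Finset.sum_subset (Finset.subset_univ _) fun a _ ha => ?_
  rw [Multiset.count_eq_zero.2 (by simpa using ha), Nat.cast_zero, zero_mul]

theorem circulantEigenvalue_zero (A : Multiset (ZMod n)) : circulantEigenvalue A 0 = A.card := by
  simp [circulantEigenvalue]

theorem circulantEigenvalue_map_mul (A : Multiset (ZMod n)) (i j : ZMod n) :
    circulantEigenvalue (A.map (i * ·)) j = circulantEigenvalue A (j * i) := by
  simp [circulantEigenvalue, mul_assoc]

theorem norm_stdAddChar (a : ZMod n) : ‖(ZMod.stdAddChar a : ℂ)‖ = 1 := by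
  rw [ZMod.stdAddChar_apply, Circle.norm_coe]

theorem norm_circulantEigenvalue_le (A : Multiset (ZMod n)) (j : ZMod n) :
    ‖circulantEigenvalue A j‖ ≤ A.card := by
  refine (norm_multiset_sum_le _).trans ?_
  simp

/-- The Fourier matrix diagonalises every circulant matrix. -/
theorem charpoly_adjMatrix_circulant (A : Multiset (ZMod n)) :
    (circulant A).adjMatrix.charpoly =
      ∏ j, (Polynomial.X - Polynomial.C (circulantEigenvalue A j)) := by
  let F : Matrix (ZMod n) (ZMod n) ℂ := Matrix.of fun u v => ZMod.stdAddChar (u * v)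
  let G : Matrix (ZMod n) (ZMod n) ℂ := Matrix.of fun u v => (n : ℂ)⁻¹ * ZMod.stdAddChar (-(u * v))
  have hFG : F * G = 1 := by
    ext u v
    have h := AddChar.sum_mulShift (u - v) (ZMod.isPrimitive_stdAddChar n)
    have : (F * G) u v = (n : ℂ)⁻¹ * ∑ x, ZMod.stdAddChar (x * (u - v)) := by
      simp only [Matrix.mul_apply, F, G, Matrix.of_apply, Finset.mul_sum]
      refine Finset.sum_congr rfl fun x _ => ?_
      rw [mul_left_comm, ← AddChar.map_add_eq_mul]
      congr 2
      ring
    rw [this, h, Matrix.one_apply, ZMod.card]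
    simp only [sub_eq_zero]
    split_ifs
    · exact inv_mul_cancel₀ (NeZero.ne _)
    · simp
  have hM : (circulant A).adjMatrix * F = F * Matrix.diagonal (circulantEigenvalue A) := by
    ext u v
    rw [Matrix.mul_diagonal, Matrix.mul_apply, circulantEigenvalue_eq_sum, Finset.mul_sum]
    refine Fintype.sum_equiv (Equiv.subRight u) _ _ fun w => ?_
    simp only [adjMatrix, circulant, F, Matrix.of_apply, Equiv.subRight_apply]
    rw [mul_left_comm, ← AddChar.map_add_eq_mul]
    congr 2
    ring
  have hconj : (circulant A).adjMatrix = F * Matrix.diagonal (circulantEigenvalue A) * G := by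
    rw [← hM, mul_assoc, hFG, mul_one]
  rw [hconj, mul_assoc, Matrix.charpoly_mul_comm, mul_assoc, mul_eq_one_comm.1 hFG, mul_one,
    Matrix.charpoly_diagonal]

theorem spectrum_circulant (A : Multiset (ZMod n)) :
    (circulant A).spectrum = Finset.univ.val.map (circulantEigenvalue A) := by
  rw [spectrum, charpoly_adjMatrix_circulant, Finset.prod,
    ← Polynomial.roots_multiset_prod_X_sub_C (Finset.univ.val.map (circulantEigenvalue A)),
    Multiset.map_map]
  rfl

theorem Isospectral.exists_circulantEigenvalue_eq {A B : Multiset (ZMod n)}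
    (h : (circulant A).Isospectral (circulant B)) (i : ZMod n) :
    ∃ j, circulantEigenvalue A i = circulantEigenvalue B j := by
  have hmem : circulantEigenvalue A i ∈ (circulant A).spectrum := by
    rw [spectrum_circulant]
    exact Multiset.mem_map_of_mem _ (Finset.mem_univ i)
  rw [h, spectrum_circulant, Multiset.mem_map] at hmem
  obtain ⟨j, -, hj⟩ := hmem
  exact ⟨j, hj.symm⟩

theorem Isospectral.circulant_card_le {A B : Multiset (ZMod n)}
    (h : (circulant A).Isospectral (circulant B)) : A.card ≤ B.card := by
  obtain ⟨j, hj⟩ := h.exists_circulantEigenvalue_eq 0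
  have := norm_circulantEigenvalue_le B j
  rw [← hj, circulantEigenvalue_zero, Complex.norm_natCast] at this
  exact_mod_cast this

theorem Isospectral.circulant_card_eq {A B : Multiset (ZMod n)}
    (h : (circulant A).Isospectral (circulant B)) : A.card = B.card :=
  le_antisymm h.circulant_card_le (Isospectral.circulant_card_le h.symm)

theorem Isospectral.circulant_order_eq {k : ℕ} [NeZero k] {A : Multiset (ZMod n)}
    {B : Multiset (ZMod k)} (h : (circulant A).Isospectral (circulant B)) : n = k := by
  have := congrArg Multiset.card h
  rw [spectrum_circulant, spectrum_circulant] at this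
  simpa using this

end MultiDigraph

/-! ### Multisets that are multiples of each other -/

theorem exists_pow_isIdempotentElem {M : Type*} [Monoid M] [Finite M] (c : M) :
    ∃ N, IsIdempotentElem (c ^ (N + 1)) := by
  obtain ⟨a, b, hne, hab⟩ := Finite.exists_ne_map_eq_of_infinite (fun k : ℕ => c ^ k)
  wlog hlt : a < b generalizing a b
  · exact this b a hne.symm hab.symm (by omega)
  obtain ⟨d, rfl⟩ := Nat.exists_eq_add_of_lt hlt
  have hper : ∀ t, c ^ (a + t * (d + 1)) = c ^ a := by
    intro t
    induction t with
    | zero => simp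
    | succ t ih =>
      rw [add_mul, one_mul, ← add_assoc, pow_add, ih, ← pow_add, ← add_assoc]
      exact hab.symm
  -- The exponent is a positive multiple of the period d + 1 and at least the preperiod a, so
  -- doubling it changes nothing.
  refine ⟨(a + 1) * (d + 1) - 1, ?_⟩
  obtain ⟨r, hr⟩ : ∃ r, (a + 1) * (d + 1) = a + r := ⟨(a + 1) * (d + 1) - a, by
    have : a ≤ (a + 1) * (d + 1) := by nlinarith
    omega⟩
  have hpos : 0 < (a + 1) * (d + 1) := by positivity
  rw [Nat.sub_add_cancel hpos, IsIdempotentElem, ← pow_add]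
  conv_lhs => rw [hr, show a + r + (a + r) = (a + (a + 1) * (d + 1)) + r by omega, pow_add, hper,
    ← pow_add, ← hr]

/-- Two multisets in a finite commutative ring that are multiples of each other differ by a unit. -/
theorem exists_unit_map_mul_eq {R : Type*} [CommRing R] [Finite R] {A B : Multiset R} {i j : R}
    (hA : A = B.map (i * ·)) (hB : B = A.map (j * ·)) : ∃ u : Rˣ, B = A.map ((u : R) * ·) := by
  obtain ⟨N, he⟩ := exists_pow_isIdempotentElem (i * j)
  set e := (i * j) ^ (N + 1) with hedef
  have hstep : A.map (i * j * ·) = A := by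
    conv_rhs => rw [hA, hB, Multiset.map_map]
    simp [mul_assoc]
  have hpow : ∀ t : ℕ, A.map ((i * j) ^ t * ·) = A := by
    intro t
    induction t with
    | zero => simp
    | succ t ih =>
      conv_rhs => rw [← hstep]
      conv_rhs => rw [← ih, Multiset.map_map]
      simp [pow_succ', mul_assoc]
  have hfix : ∀ a ∈ A, e * a = a := by
    intro a ha
    rw [← hpow (N + 1), Multiset.mem_map] at ha
    obtain ⟨b, -, rfl⟩ := ha
    rw [← mul_assoc, he]
  have hinv : j * (i ^ (N + 1) * j ^ N) = e := by
    rw [hedef]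
    ring
  have he' : e * e = e := he
  -- The unit is j on the factor eR, where j is invertible, and 1 on the complement; since e fixes
  -- A, it acts on A as j.
  have huv : (e * j + (1 - e)) * (e * (i ^ (N + 1) * j ^ N) + (1 - e)) = 1 := by
    linear_combination (e * e) * hinv +
      (e + 2 - j - i ^ (N + 1) * j ^ N) * he'
  refine ⟨Units.mkOfMulEqOne _ _ huv, ?_⟩
  conv_lhs => rw [hB]
  refine Multiset.map_congr rfl fun a ha => ?_
  simp only [Units.val_mkOfMulEqOne]
  linear_combination (1 - j) * hfix a ha

/-! ### Propagation of an eigenvalue equality from index 1 -/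

namespace MultiDigraph

open Polynomial in
/-- The generating polynomial of a multiset of residues. -/
noncomputable def residuePolynomial {n : ℕ} (A : Multiset (ZMod n)) : ℤ[X] :=
  (A.map fun a => X ^ a.val).sum

open Polynomial in
theorem aeval_residuePolynomial {n : ℕ} (A : Multiset (ZMod n)) (z : ℂ) :
    aeval z (residuePolynomial A) = (A.map fun a => z ^ a.val).sum := by
  simp [residuePolynomial, map_multiset_sum]

open Polynomial in
theorem norm_aeval_residuePolynomial_le {n : ℕ} (A : Multiset (ZMod n)) {z : ℂ} (hz : ‖z‖ = 1) :
    ‖aeval z (residuePolynomial A)‖ ≤ A.card := by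
  rw [aeval_residuePolynomial]
  refine (norm_multiset_sum_le _).trans ?_
  simp [hz]

/-- The generator `n / p` of the subgroup of order `p` of `ℤ/n`. -/
def torsionGenerator (n p : ℕ) : ZMod n := ((n / p : ℕ) : ZMod n)

/-- The coset of `x` modulo the subgroup of order `p` of `ℤ/n`. -/
def torsionCoset {n : ℕ} (p : ℕ) (x : ZMod n) : Multiset (ZMod n) :=
  (Multiset.range p).map fun k => x + k • torsionGenerator n p

theorem card_torsionCoset {n : ℕ} (p : ℕ) (x : ZMod n) : (torsionCoset p x).card = p := by
  simp [torsionCoset]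

variable {n : ℕ} [NeZero n]

theorem stdAddChar_pow_val (z a : ZMod n) :
    (ZMod.stdAddChar z : ℂ) ^ a.val = ZMod.stdAddChar (a * z) := by
  rw [← AddChar.map_nsmul_eq_pow, nsmul_eq_mul, ZMod.natCast_zmod_val]

open Polynomial in
theorem aeval_stdAddChar_residuePolynomial (A : Multiset (ZMod n)) (j : ZMod n) :
    aeval (ZMod.stdAddChar j : ℂ) (residuePolynomial A) = circulantEigenvalue A j := by
  simp only [aeval_residuePolynomial, stdAddChar_pow_val, circulantEigenvalue, mul_comm]

/-- An equality between eigenvalues propagates to the indices prime to `p`, when all prime factors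
of the order other than `p` are large compared with the connection multisets. -/
theorem circulantEigenvalue_eq_of_forall_prime_lt {p : ℕ} {A B : Multiset (ZMod n)}
    (hbig : ∀ q : ℕ, q.Prime → q ∣ n → q ≠ p → A.card + B.card < q)
    (h : circulantEigenvalue A 1 = circulantEigenvalue B 1) {j : ZMod n} (hj : ¬ p ∣ j.val) :
    circulantEigenvalue A j = circulantEigenvalue B j := by
  have hj0 : j.val ≠ 0 := fun h0 => hj (h0 ▸ dvd_zero p)
  have hroot : (ZMod.stdAddChar (1 : ZMod n) : ℂ) ^ n = 1 := by
    rw [← AddChar.map_nsmul_eq_pow]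
    simp
  have h0 : Polynomial.aeval (ZMod.stdAddChar (1 : ZMod n) : ℂ)
      (residuePolynomial A - residuePolynomial B) = 0 := by
    rw [map_sub, aeval_stdAddChar_residuePolynomial, aeval_stdAddChar_residuePolynomial, h, sub_self]
  have := aeval_pow_eq_zero (NeZero.ne n) hj0 (fun q hq hqj hqn z hz => ?_) hroot h0
  · rw [stdAddChar_pow_val, mul_one, map_sub, aeval_stdAddChar_residuePolynomial,
      aeval_stdAddChar_residuePolynomial] at this
    exact sub_eq_zero.1 this
  · rw [map_sub]
    refine (norm_sub_le _ _).trans_lt ((add_le_add (norm_aeval_residuePolynomial_le A hz)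
      (norm_aeval_residuePolynomial_le B hz)).trans_lt ?_)
    exact_mod_cast hbig q hq hqn fun hqp => hj (hqp ▸ hqj)

/-- On the unit circle conjugation is inversion, so a nonzero sum determines the product and hence
the pair. If the sum is 0, odd powers cancel too. -/
theorem pow_add_pow_eq_of_norm_eq_one {z₁ z₂ w₁ w₂ : ℂ} (hz₁ : ‖z₁‖ = 1) (hz₂ : ‖z₂‖ = 1)
    (hw₁ : ‖w₁‖ = 1) (hw₂ : ‖w₂‖ = 1) (h : z₁ + z₂ = w₁ + w₂) {k : ℕ} (hk : Odd k) :
    z₁ ^ k + z₂ ^ k = w₁ ^ k + w₂ ^ k := by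
  have ne : ∀ {z : ℂ}, ‖z‖ = 1 → z ≠ 0 := fun hz h0 => by simp [h0] at hz
  by_cases h0 : z₁ + z₂ = 0
  · have h0' := h ▸ h0
    rw [eq_neg_of_add_eq_zero_left h0, eq_neg_of_add_eq_zero_left h0', hk.neg_pow, hk.neg_pow,
      neg_add_cancel, neg_add_cancel]
  · have hc := congrArg (starRingEnd ℂ) h
    rw [map_add, map_add, ← Complex.inv_eq_conj hz₁, ← Complex.inv_eq_conj hz₂,
      ← Complex.inv_eq_conj hw₁, ← Complex.inv_eq_conj hw₂] at hc
    have n1 := ne hz₁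
    have n2 := ne hz₂
    have n3 := ne hw₁
    have n4 := ne hw₂
    field_simp at hc
    have hprod : z₁ * z₂ = w₁ * w₂ := by
      apply mul_left_cancel₀ h0
      linear_combination -hc + z₁ * z₂ * h
    have : (z₁ - w₁) * (z₁ - w₂) = 0 := by linear_combination z₁ * h - hprod
    rcases mul_eq_zero.1 this with h1 | h1
    · rw [sub_eq_zero] at h1
      subst h1
      rw [add_left_cancel h]
    · rw [sub_eq_zero] at h1
      subst h1
      rw [add_comm w₁] at h
      rw [add_left_cancel h, add_comm]

theorem circulantEigenvalue_eq_of_card_eq_two {A B : Multiset (ZMod n)} (hA : A.card = 2)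
    (hB : B.card = 2) (h : circulantEigenvalue A 1 = circulantEigenvalue B 1) {j : ZMod n}
    (hj : ¬ 2 ∣ j.val) : circulantEigenvalue A j = circulantEigenvalue B j := by
  obtain ⟨a, b, rfl⟩ := Multiset.card_eq_two.1 hA
  obtain ⟨c, d, rfl⟩ := Multiset.card_eq_two.1 hB
  have hodd : Odd j.val := Nat.odd_iff.2 (Nat.two_dvd_ne_zero.1 hj)
  have := pow_add_pow_eq_of_norm_eq_one (norm_stdAddChar a) (norm_stdAddChar b)
    (norm_stdAddChar c) (norm_stdAddChar d) (by simpa [circulantEigenvalue] using h) hodd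
  simpa [stdAddChar_pow_val, circulantEigenvalue] using this

/-! ### The subgroup of order p, its cosets and periodicity -/

theorem torsionGenerator_mul_eq_zero_iff {p : ℕ} (hpn : p ∣ n) (j : ZMod n) :
    torsionGenerator n p * j = 0 ↔ p ∣ j.val := by
  obtain ⟨d, hd⟩ := hpn
  have hp : 0 < p := Nat.pos_of_ne_zero fun h => NeZero.ne n (by rw [hd, h, zero_mul])
  have hd0 : 0 < d := Nat.pos_of_ne_zero fun h => NeZero.ne n (by rw [hd, h, mul_zero])
  conv_lhs => rw [← ZMod.natCast_zmod_val j]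
  rw [torsionGenerator, ← Nat.cast_mul, ZMod.natCast_eq_zero_iff]
  have : n / p = d := by rw [hd, Nat.mul_div_cancel_left d hp]
  rw [this, ← Nat.mul_dvd_mul_iff_left (a := d) (b := p) hd0]
  exact iff_of_eq (congrArg (· ∣ d * j.val) (hd.trans (mul_comm p d)))

theorem torsionGenerator_nsmul_eq_zero_iff {p : ℕ} (hpn : p ∣ n) (k : ℕ) :
    k • torsionGenerator n p = 0 ↔ p ∣ k := by
  rw [nsmul_eq_mul, mul_comm, torsionGenerator_mul_eq_zero_iff hpn, ZMod.val_natCast,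
    Nat.dvd_mod_iff hpn]

theorem exists_eq_nsmul_torsionGenerator {p : ℕ} (hpn : p ∣ n) {a : ZMod n}
    (ha : (p : ZMod n) * a = 0) : ∃ k : ℕ, a = k • torsionGenerator n p := by
  obtain ⟨d, hd⟩ := hpn
  have hp : 0 < p := Nat.pos_of_ne_zero fun h => NeZero.ne n (by rw [hd, h, zero_mul])
  rw [← ZMod.natCast_zmod_val a, ← Nat.cast_mul, ZMod.natCast_eq_zero_iff] at ha
  have hda : d ∣ a.val := (Nat.mul_dvd_mul_iff_left hp).1 (hd ▸ ha)
  obtain ⟨k, hk⟩ := hda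
  refine ⟨k, ?_⟩
  have : n / p = d := by rw [hd, Nat.mul_div_cancel_left d hp]
  rw [torsionGenerator, this, nsmul_eq_mul, ← Nat.cast_mul, mul_comm, ← hk, ZMod.natCast_zmod_val]

open ZMod in
/-- If the eigenvalues agree at all indices prime to `p`, then the difference of the connection
multisets is periodic under the subgroup of order `p`. -/
theorem count_add_torsionGenerator {p : ℕ} {A B : Multiset (ZMod n)}
    (h : ∀ j : ZMod n, torsionGenerator n p * j ≠ 0 →
      circulantEigenvalue A j = circulantEigenvalue B j) (x : ZMod n) :
    (A.count (x + torsionGenerator n p) : ℤ) - B.count (x + torsionGenerator n p) =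
      A.count x - B.count x := by
  set t := torsionGenerator n p
  let f : ZMod n → ℂ := fun x => A.count x - B.count x
  have hf : ∀ k, ∑ x, stdAddChar (-(x * k)) * f x =
      circulantEigenvalue A (-k) - circulantEigenvalue B (-k) := by
    intro k
    simp only [circulantEigenvalue_eq_sum, ← Finset.sum_sub_distrib, f]
    refine Finset.sum_congr rfl fun x _ => ?_
    rw [show -(x * k) = -k * x by ring]
    ring
  have hshift : ∀ k, ∑ x, stdAddChar (-(x * k)) * f (x + t) =
      stdAddChar (t * k) * ∑ x, stdAddChar (-(x * k)) * f x := by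
    intro k
    rw [Finset.mul_sum]
    refine Fintype.sum_equiv (Equiv.addRight t) _ _ fun x => ?_
    rw [Equiv.coe_addRight, ← mul_assoc, ← AddChar.map_add_eq_mul]
    congr 2
    ring
  have hdft : dft (fun x => f (x + t) - f x) = 0 := by
    ext k
    simp only [dft_apply, smul_eq_mul, mul_sub, Finset.sum_sub_distrib, Pi.zero_apply]
    rw [hshift, hf]
    by_cases hk : t * k = 0
    · rw [hk, AddChar.map_zero_eq_one, one_mul, sub_self]
    · rw [h (-k) (by rwa [mul_neg, neg_ne_zero]), sub_self, mul_zero, sub_zero]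
  have := congrFun (dft.map_eq_zero_iff.1 hdft) x
  simp only [f, Pi.zero_apply, sub_eq_zero] at this
  exact_mod_cast this

theorem nodup_torsionCoset {p : ℕ} (hpn : p ∣ n) (x : ZMod n) : (torsionCoset p x).Nodup := by
  refine Multiset.Nodup.map_on (fun a ha b hb hab => ?_) (Multiset.nodup_range p)
  rw [Multiset.mem_range] at ha hb
  replace hab := add_left_cancel hab
  wlog hle : a ≤ b generalizing a b
  · exact (this b hb a ha hab.symm (by omega)).symm
  have : p ∣ b - a := by
    rw [← torsionGenerator_nsmul_eq_zero_iff hpn, sub_nsmul _ hle, hab, add_neg_cancel]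
  have := Nat.eq_zero_of_dvd_of_lt this (by omega)
  omega

theorem add_nsmul_mem_torsionCoset {p : ℕ} (hp : 0 < p) (hpn : p ∣ n) (x : ZMod n) (k : ℕ) :
    x + k • torsionGenerator n p ∈ torsionCoset p x := by
  refine Multiset.mem_map.2 ⟨k % p, Multiset.mem_range.2 (Nat.mod_lt k hp), ?_⟩
  conv_rhs => rw [← Nat.mod_add_div k p]
  rw [add_nsmul, (torsionGenerator_nsmul_eq_zero_iff hpn _).2 (dvd_mul_right p _), add_zero]

theorem eq_torsionCoset {p : ℕ} (hpn : p ∣ n) {A : Multiset (ZMod n)} {x : ZMod n}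
    (hA : A.card ≤ p) (h : ∀ k : ℕ, x + k • torsionGenerator n p ∈ A) : A = torsionCoset p x := by
  refine (Multiset.eq_of_le_of_card_le ((Multiset.le_iff_subset (nodup_torsionCoset hpn x)).2 ?_)
    (hA.trans (card_torsionCoset p x).ge)).symm
  intro a ha
  obtain ⟨k, -, rfl⟩ := Multiset.mem_map.1 ha
  exact h k

theorem torsionCoset_add_nsmul {p : ℕ} (hp : 0 < p) (hpn : p ∣ n) (x : ZMod n) (k : ℕ) :
    torsionCoset p (x + k • torsionGenerator n p) = torsionCoset p x := by
  symm
  refine eq_torsionCoset hpn (card_torsionCoset p x).le fun l => ?_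
  rw [add_assoc, ← add_nsmul]
  exact add_nsmul_mem_torsionCoset hp hpn x _

theorem map_mul_torsionCoset {p : ℕ} (hp : p.Prime) (hpn : p ∣ n) (x : ZMod n) {i : ZMod n}
    (hi : torsionGenerator n p * i ≠ 0) :
    (torsionCoset p x).map (i * ·) = torsionCoset p (i * x) := by
  refine eq_torsionCoset hpn (by rw [Multiset.card_map, card_torsionCoset]) fun k => ?_
  rw [Ne, torsionGenerator_mul_eq_zero_iff hpn] at hi
  -- t inverts i modulo p, so i permutes the subgroup of order p.
  obtain ⟨t, -, ht⟩ := Nat.exists_mul_mod_eq_one_of_coprime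
    ((Nat.Prime.coprime_iff_not_dvd hp).2 hi).symm hp.one_lt
  refine Multiset.mem_map.2 ⟨_, add_nsmul_mem_torsionCoset hp.pos hpn x (t * k), ?_⟩
  have h1 : (i.val * t) • torsionGenerator n p = torsionGenerator n p := by
    rw [← Nat.mod_add_div (i.val * t) p, ht, add_nsmul,
      (torsionGenerator_nsmul_eq_zero_iff hpn _).2 (dvd_mul_right p _), add_zero, one_nsmul]
  simp only [nsmul_eq_mul, Nat.cast_mul, ZMod.natCast_zmod_val] at h1 ⊢
  linear_combination (k : ZMod n) * h1

theorem circulantEigenvalue_torsionCoset_of_eq_zero {p : ℕ} (x : ZMod n) {j : ZMod n}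
    (hj : torsionGenerator n p * j = 0) :
    circulantEigenvalue (torsionCoset p x) j = p * ZMod.stdAddChar (j * x) := by
  have : ∀ k : ℕ, j * (x + k • torsionGenerator n p) = j * x := fun k => by
    rw [nsmul_eq_mul]
    linear_combination (k : ZMod n) * hj
  simp only [circulantEigenvalue, torsionCoset, Multiset.map_map, Function.comp_apply, this]
  simp

theorem circulantEigenvalue_torsionCoset_of_ne_zero {p : ℕ} (hpn : p ∣ n) (x : ZMod n) {j : ZMod n}
    (hj : torsionGenerator n p * j ≠ 0) : circulantEigenvalue (torsionCoset p x) j = 0 := by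
  have hterm : ∀ k : ℕ, (ZMod.stdAddChar (j * (x + k • torsionGenerator n p)) : ℂ) =
      ZMod.stdAddChar (j * x) * ZMod.stdAddChar (torsionGenerator n p * j) ^ k := fun k => by
    rw [← AddChar.map_nsmul_eq_pow, ← AddChar.map_add_eq_mul]
    simp only [nsmul_eq_mul]
    congr 1
    ring
  have hne : (ZMod.stdAddChar (torsionGenerator n p * j) : ℂ) ≠ 1 := fun h1 => hj
    (ZMod.injective_stdAddChar (h1.trans (AddChar.map_zero_eq_one _).symm))
  have hpow : (ZMod.stdAddChar (torsionGenerator n p * j) : ℂ) ^ p = 1 := by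
    rw [← AddChar.map_nsmul_eq_pow, ← smul_mul_assoc,
      (torsionGenerator_nsmul_eq_zero_iff hpn p).2 dvd_rfl, zero_mul, AddChar.map_zero_eq_one]
  have : circulantEigenvalue (torsionCoset p x) j =
      ∑ k ∈ Finset.range p, ZMod.stdAddChar (j * (x + k • torsionGenerator n p)) := by
    simp [circulantEigenvalue, torsionCoset, Finset.sum, -nsmul_eq_mul]
  rw [this]
  simp only [hterm]
  rw [← Finset.mul_sum, geom_sum_eq hne, hpow, sub_self, zero_div, mul_zero]

/-- The surplus of A over B at x recurs along the coset of x, so A contains all p of its elements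
and has room for no more. -/
theorem exists_eq_torsionCoset_of_count_lt {p : ℕ} (hpn : p ∣ n) {A B : Multiset (ZMod n)}
    (hA : A.card ≤ p)
    (hper : ∀ x : ZMod n, (A.count (x + torsionGenerator n p) : ℤ) -
      B.count (x + torsionGenerator n p) = A.count x - B.count x)
    {x : ZMod n} (hx : B.count x < A.count x) : A = torsionCoset p x := by
  refine eq_torsionCoset hpn hA fun k => ?_
  have : ∀ k : ℕ, (A.count (x + k • torsionGenerator n p) : ℤ) -
      B.count (x + k • torsionGenerator n p) = A.count x - B.count x := by
    intro k
    induction k with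
    | zero => simp
    | succ k ih => rw [succ_nsmul, ← add_assoc, hper, ih]
  have := this k
  exact Multiset.count_pos.1 (by omega)

theorem eq_or_exists_eq_torsionCoset {p : ℕ} (hpn : p ∣ n) {A B : Multiset (ZMod n)}
    (hAB : A.card = B.card) (hA : A.card ≤ p)
    (h : ∀ j : ZMod n, ¬ p ∣ j.val → circulantEigenvalue A j = circulantEigenvalue B j) :
    A = B ∨ (∃ x, A = torsionCoset p x) ∧ ∃ y, B = torsionCoset p y := by
  have h' : ∀ j : ZMod n, torsionGenerator n p * j ≠ 0 →
      circulantEigenvalue A j = circulantEigenvalue B j := fun j hj =>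
    h j fun hpj => hj ((torsionGenerator_mul_eq_zero_iff hpn j).2 hpj)
  have exists_lt : ∀ C D : Multiset (ZMod n), C.card = D.card → C ≠ D →
      ∃ x, D.count x < C.count x := by
    intro C D hcard hne
    by_contra! hle
    exact hne (Multiset.eq_of_le_of_card_le (Multiset.le_iff_count.2 hle) hcard.ge)
  by_cases hne : A = B
  · exact Or.inl hne
  · obtain ⟨x, hx⟩ := exists_lt A B hAB hne
    obtain ⟨y, hy⟩ := exists_lt B A hAB.symm (Ne.symm hne)
    exact Or.inr ⟨⟨x, exists_eq_torsionCoset_of_count_lt hpn hA (count_add_torsionGenerator h') hx⟩,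
      ⟨y, exists_eq_torsionCoset_of_count_lt hpn (hAB ▸ hA)
        (count_add_torsionGenerator fun j hj => (h' j hj).symm) hy⟩⟩

theorem circulantEigenvalue_one_torsionCoset {p : ℕ} (hp : p.Prime) (hpn : p ∣ n) (x : ZMod n) :
    circulantEigenvalue (torsionCoset p x) 1 = 0 := by
  refine circulantEigenvalue_torsionCoset_of_ne_zero hpn x ?_
  rw [mul_one, ← one_nsmul (torsionGenerator n p), Ne, torsionGenerator_nsmul_eq_zero_iff hpn]
  exact hp.one_lt.ne' ∘ Nat.dvd_one.1

/-- If i killed the subgroup, every eigenvalue of the image would have modulus p; a zero eigenvalue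
excludes this. -/
theorem exists_map_mul_torsionCoset_eq {p : ℕ} (hp : p.Prime) (hpn : p ∣ n) {y i j : ZMod n}
    (h0 : circulantEigenvalue ((torsionCoset p y).map (i * ·)) j = 0) :
    ∃ x, (torsionCoset p y).map (i * ·) = torsionCoset p x := by
  by_cases hi : torsionGenerator n p * i = 0
  · rw [circulantEigenvalue_map_mul, circulantEigenvalue_torsionCoset_of_eq_zero] at h0
    · rcases mul_eq_zero.1 h0 with h | h
      · exact absurd (Nat.cast_eq_zero.1 h) hp.ne_zero
      · have := norm_stdAddChar (j * i * y)
        rw [h, norm_zero] at this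
        exact absurd this zero_ne_one
    · linear_combination j * hi
  · exact ⟨_, map_mul_torsionCoset hp hpn y hi⟩

/-! ### From isospectrality to isomorphism -/

/-- The eigenvalue at index p is nonzero, so it can only match one at a multiple of p, and such
eigenvalues are p times a character value. -/
theorem Isospectral.exists_mul_eq_of_torsionCoset {p : ℕ} (hp : p.Prime) (hpn : p ∣ n)
    {x y : ZMod n}
    (h : (circulant (torsionCoset p x)).Isospectral (circulant (torsionCoset p y))) :
    ∃ i : ZMod n, p * x = i * (p * y) := by
  have hp0 : (p : ℂ) ≠ 0 := Nat.cast_ne_zero.2 hp.ne_zero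
  have ht : torsionGenerator n p * p = 0 := by
    rw [mul_comm, ← nsmul_eq_mul, torsionGenerator_nsmul_eq_zero_iff hpn]
  obtain ⟨j, hj⟩ := h.exists_circulantEigenvalue_eq p
  rw [circulantEigenvalue_torsionCoset_of_eq_zero x ht] at hj
  by_cases hj0 : torsionGenerator n p * j = 0
  · rw [circulantEigenvalue_torsionCoset_of_eq_zero y hj0] at hj
    have hxy := ZMod.injective_stdAddChar (mul_left_cancel₀ hp0 hj)
    obtain ⟨i, hi⟩ := (torsionGenerator_mul_eq_zero_iff hpn j).1 hj0
    refine ⟨i, ?_⟩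
    rw [hxy, ← ZMod.natCast_zmod_val j, hi, Nat.cast_mul]
    ring
  · rw [circulantEigenvalue_torsionCoset_of_ne_zero hpn y hj0] at hj
    have := norm_stdAddChar ((p : ZMod n) * x)
    rw [(mul_eq_zero.1 hj).resolve_left hp0, norm_zero] at this
    exact absurd this zero_ne_one

theorem Isospectral.isomorphic_torsionCoset {p : ℕ} (hp : p.Prime) (hpn : p ∣ n) {x y : ZMod n}
    (h : (circulant (torsionCoset p x)).Isospectral (circulant (torsionCoset p y))) :
    (circulant (torsionCoset p x)).Isomorphic (circulant (torsionCoset p y)) := by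
  obtain ⟨i, hi⟩ := h.exists_mul_eq_of_torsionCoset hp hpn
  obtain ⟨j, hj⟩ := Isospectral.exists_mul_eq_of_torsionCoset hp hpn h.symm
  -- px and py are multiples of each other, hence associates; py = u(px) puts y - ux in the subgroup
  -- of order p.
  obtain ⟨u, hu⟩ := exists_unit_map_mul_eq (A := {(p : ZMod n) * x}) (B := {(p : ZMod n) * y})
    (i := i) (j := j) (by simp [← hi]) (by simp [← hj])
  rw [Multiset.map_singleton, Multiset.singleton_inj] at hu
  obtain ⟨k, hk⟩ := exists_eq_nsmul_torsionGenerator hpn (a := y - u * x)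
    (by linear_combination hu)
  have hut : torsionGenerator n p * u ≠ 0 := by
    rw [Ne, Units.mul_left_eq_zero, ← one_nsmul (torsionGenerator n p),
      torsionGenerator_nsmul_eq_zero_iff hpn]
    exact hp.one_lt.ne' ∘ Nat.dvd_one.1
  rw [show y = u * x + k • torsionGenerator n p by rw [← hk]; ring,
    torsionCoset_add_nsmul hp.pos hpn, ← map_mul_torsionCoset hp hpn x hut]
  exact circulant_isomorphic_map_mul_unit _ u

/-- Isospectral circulants are isomorphic as soon as, for connection multisets of the given size,
the first eigenvalue determines the eigenvalues at all indices prime to `p`. -/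
theorem Isospectral.isomorphic_circulant {p m : ℕ} (hp : p.Prime) (hpn : p ∣ n) (hm : m ≤ p)
    (hprop : ∀ C D : Multiset (ZMod n), C.card = m → D.card = m →
      circulantEigenvalue C 1 = circulantEigenvalue D 1 →
      ∀ j : ZMod n, ¬ p ∣ j.val → circulantEigenvalue C j = circulantEigenvalue D j)
    {A B : Multiset (ZMod n)} (hA : A.card = m)
    (h : (circulant A).Isospectral (circulant B)) :
    (circulant A).Isomorphic (circulant B) := by
  have step : ∀ {C D : Multiset (ZMod n)}, C.card = m → D.card = m →
      (circulant C).Isospectral (circulant D) →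
      (∃ i : ZMod n, C = D.map (i * ·)) ∨ ∃ x, C = torsionCoset p x := by
    intro C D hC hD hCD
    obtain ⟨i, hi⟩ := hCD.exists_circulantEigenvalue_eq 1
    -- The eigenvalue of D at i is the first eigenvalue of iD, so C is compared with iD.
    rw [← one_mul i, ← circulantEigenvalue_map_mul] at hi
    have hD' : (D.map (i * ·)).card = m := by rw [Multiset.card_map, hD]
    rcases eq_or_exists_eq_torsionCoset hpn (hC.trans hD'.symm) (hC.trans_le hm)
      (hprop _ _ hC hD' hi) with h1 | h1
    · exact Or.inl ⟨i, h1⟩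
    · exact Or.inr h1.1
  have coset_of_map : ∀ {C D : Multiset (ZMod n)} {i y : ZMod n},
      (circulant C).Isospectral (circulant D) → C = D.map (i * ·) → D = torsionCoset p y →
      ∃ x, C = torsionCoset p x := by
    intro C D i y hCD hC hD
    -- The coset D has first eigenvalue 0, so C = iD also has 0 as an eigenvalue.
    obtain ⟨j, hj⟩ := Isospectral.exists_circulantEigenvalue_eq hCD.symm 1
    subst hD
    rw [circulantEigenvalue_one_torsionCoset hp hpn] at hj
    rw [hC] at hj ⊢
    exact exists_map_mul_torsionCoset_eq hp hpn hj.symm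
  have hB : B.card = m := h.circulant_card_eq ▸ hA
  have both : ∀ {x y : ZMod n}, A = torsionCoset p x → B = torsionCoset p y →
      (circulant A).Isomorphic (circulant B) := by
    rintro x y rfl rfl
    exact h.isomorphic_torsionCoset hp hpn
  rcases step hA hB h with ⟨i, hi⟩ | ⟨x, hx⟩ <;> rcases step hB hA h.symm with ⟨j, hj⟩ | ⟨y, hy⟩
  · obtain ⟨u, rfl⟩ := exists_unit_map_mul_eq hi hj
    exact circulant_isomorphic_map_mul_unit A u
  · obtain ⟨x, hx⟩ := coset_of_map h hi hy
    exact both hx hy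
  · obtain ⟨y, hy⟩ := coset_of_map h.symm hj hx
    exact both hx hy
  · exact both hx hy

end MultiDigraph

theorem theorem1
    (s : ℕ) (hs : 0 < s) (p r : Fin s → ℕ)
    (hp : ∀ i, (p i).Prime) (hmono : StrictMono p) (hr : ∀ i, 1 ≤ r i)
    (n : ℕ) [NeZero n] (hn : n = ∏ i, p i ^ r i)
    (m : ℕ) (A : Multiset (ZMod n)) (hA : A.card = m)
    (hm : m ≤ p ⟨0, hs⟩)
    (h2 : s = 1 ∨ ∃ h : 1 < s, (p ⟨0, hs⟩ : ℤ) * ((m : ℤ) - 1) < (p ⟨1, h⟩ : ℤ))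
    (k : ℕ) [NeZero k] (B : Multiset (ZMod k))
    (hiso : (MultiDigraph.circulant A).Isospectral (MultiDigraph.circulant B)) :
    (MultiDigraph.circulant A).Isomorphic (MultiDigraph.circulant B) := by
  obtain rfl := hiso.circulant_order_eq
  have hpn : p ⟨0, hs⟩ ∣ n := by
    rw [hn]
    exact (dvd_pow_self _ (Nat.one_le_iff_ne_zero.1 (hr _))).trans
      (Finset.dvd_prod_of_mem (fun i => p i ^ r i) (Finset.mem_univ _))
  refine hiso.isomorphic_circulant (hp ⟨0, hs⟩) hpn hm (fun C D hC hD hCD j hj => ?_) hA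
  have hlarge : ∀ q : ℕ, q.Prime → q ∣ n → q ≠ p ⟨0, hs⟩ →
      ∃ h : 1 < s, (p ⟨0, hs⟩ : ℤ) * ((m : ℤ) - 1) < (p ⟨1, h⟩ : ℤ) ∧
        p ⟨0, hs⟩ < p ⟨1, h⟩ ∧ p ⟨1, h⟩ ≤ q := by
    intro q hq hqn hne
    rw [hn, hq.prime.dvd_finsetProd_iff] at hqn
    obtain ⟨i, -, hi⟩ := hqn
    obtain rfl := (Nat.prime_dvd_prime_iff_eq hq (hp i)).1 (hq.dvd_of_dvd_pow hi)
    have hi0 : i.val ≠ 0 := fun h0 => hne (congrArg p (Fin.ext h0))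
    have hs1 : 1 < s := by omega
    obtain ⟨h, hlt⟩ := h2.resolve_left (by omega)
    exact ⟨h, hlt, hmono (Fin.mk_lt_mk.2 zero_lt_one),
      hmono.monotone (Fin.mk_le_of_le_val (by omega))⟩
  -- Only here can 2m < p_2 fail: p_2 may be 3. Sums of two roots of unity are treated directly.
  by_cases h22 : p ⟨0, hs⟩ = 2 ∧ m = 2
  · rw [h22.1] at hj
    rw [h22.2] at hC hD
    exact MultiDigraph.circulantEigenvalue_eq_of_card_eq_two hC hD hCD hj
  · refine MultiDigraph.circulantEigenvalue_eq_of_forall_prime_lt (fun q hq hqn hne => ?_) hCD hj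
    obtain ⟨h, hlt, h01, h1q⟩ := hlarge q hq hqn hne
    rw [hC, hD]
    refine lt_of_lt_of_le ?_ h1q
    have h0 := (hp ⟨0, hs⟩).two_le
    rcases Nat.lt_or_ge m 3 with hm3 | hm3
    · by_cases hm2 : m = 2
      -- Now p_1 ≥ 3, so the odd prime p_2 is at least 5 > 2m.
      · have hodd := (hp ⟨1, h⟩).eq_two_or_odd
        have h3 : p ⟨0, hs⟩ ≠ 2 := fun h' => h22 ⟨h', hm2⟩
        omega
      · omega
    -- For m ≥ 3, 2m ≤ m(m - 1) ≤ p_1(m - 1) < p_2.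
    · have : (2 * m : ℤ) ≤ p ⟨0, hs⟩ * (m - 1) := by
        have h1 : (m : ℤ) ≤ p ⟨0, hs⟩ := by exact_mod_cast hm
        have h2 : (3 : ℤ) ≤ m := by exact_mod_cast hm3
        nlinarith
      omega
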